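/- **Theorem 1.5.** For $n\ge 1$ let $O_n$ be the linear crossed octagonal graph: the simple graph on the $6n+2$ vertices $1,\dots,3n+1,1',\dots,(3n+1)'$ obtained from the linear chain of $n$ octagons (with edges $\{i,i+1\}$ and $\{i',(i+1)'\}$ for $1\le i\le 3n$, and $\{3s+1,(3s+1)'\}$ for $0\le s\le n$) by adding the crossed edges $\{i,(i+1)'\}$ and $\{i',i+1\}$ for $1\le i\le 3n$. For a connected finite graph $G$ with vertex degrees $d_u$, let $\mathrm{Gut}(G)=\sum_{\{u,v\}} d_u d_v\, d(u,v)$ be its Gutman index and $Kf^*(G)=\sum_{\{u,v\}} d_u d_v\, r(u,v)$ its multiplicative degree-Kirchhoff index, both sums running over all unordered pairs of distinct vertices, where $d(u,v)$ is the shortest-path distance and $r(u,v)$ is the resistance distance, that is, the effective resistance between $u$ and $v$ when each edge is a unit resistor. Then $$\lim_{n\to\infty}\frac{Kf^*(O_n)}{\mathrm{Gut}(O_n)}=\frac14 .$$ -/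

import Mathlib

open Filter Topology

namespace SimpleGraph

section ElectricalNetwork

variable {V : Type*} [Fintype V] [DecidableEq V] (G : SimpleGraph V) [DecidableRel G.Adj]

/-- `p` is a vector of electric potentials on the network obtained from `G` by putting a unit
resistor on each edge, when a unit current enters at `u` and leaves at `v`. By Ohm's law the current
along an edge from `w` to `x` is `p w - p x`, so Kirchhoff's current law says that the Laplacian of
`G` maps `p` to the indicator of `u` minus the indicator of `v`. -/
def IsUnitCurrentPotential (u v : V) (p : V → ℝ) : Prop :=
  (G.lapMatrix ℝ).mulVec p = Pi.single u 1 - Pi.single v 1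

/-- The potential difference between `u` and `v` does not depend on the potential chosen. -/
theorem IsUnitCurrentPotential.sub_eq {G : SimpleGraph V} [DecidableRel G.Adj] {u v : V}
    {p q : V → ℝ} (hp : G.IsUnitCurrentPotential u v p) (hq : G.IsUnitCurrentPotential u v q) :
    p u - p v = q u - q v := by
  unfold IsUnitCurrentPotential at hp hq
  have h1 : dotProduct q ((G.lapMatrix ℝ).mulVec p) = dotProduct p ((G.lapMatrix ℝ).mulVec q) := by
    rw [Matrix.dotProduct_mulVec, ← Matrix.mulVec_transpose, (G.isSymm_lapMatrix (R := ℝ)).eq,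
      dotProduct_comm]
  rw [hp, hq] at h1
  simpa [dotProduct_sub] using h1.symm

/-- In a connected graph there is such a potential for every pair of vertices. -/
theorem Connected.exists_isUnitCurrentPotential {G : SimpleGraph V} [DecidableRel G.Adj]
    (hG : G.Connected) (u v : V) : ∃ p : V → ℝ, G.IsUnitCurrentPotential u v p := by
  classical
  set L := G.lapMatrix ℝ with hL
  have hone : ∀ p : V → ℝ, ∑ w, L.mulVec p w = 0 := by
    intro p
    have h : dotProduct (fun _ => (1 : ℝ)) (L.mulVec p) = 0 := by
      rw [Matrix.dotProduct_mulVec, ← Matrix.mulVec_transpose, hL,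
        (G.isSymm_lapMatrix (R := ℝ)).eq, G.lapMatrix_mulVec_const_eq_zero, zero_dotProduct]
    simpa [dotProduct] using h
  have hcard : (Fintype.card V : ℝ) ≠ 0 := by
    have : Nonempty V := hG.nonempty
    exact_mod_cast Fintype.card_ne_zero
  have key : ∀ p b : V → ℝ, ∑ w, b w = 0 → (∀ w, L.mulVec p w + ∑ x, p x = b w) →
      ∑ x, p x = 0 := by
    intro p b hb h
    have h2 : ∑ w, (L.mulVec p w + ∑ x, p x) = 0 := by rw [← hb]; exact Finset.sum_congr rfl fun w _ => h w
    rw [Finset.sum_add_distrib, hone] at h2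
    simpa [hcard] using h2
  let f : (V → ℝ) →ₗ[ℝ] (V → ℝ) :=
    { toFun := fun p w => L.mulVec p w + ∑ x, p x
      map_add' := by
        intro p q; ext w
        simp [Matrix.mulVec_add, Finset.sum_add_distrib]; ring
      map_smul' := by
        intro c p; ext w
        simp [Matrix.mulVec_smul, Finset.mul_sum, mul_add] }
  have hf : Function.Injective f := by
    rw [injective_iff_map_eq_zero]
    intro p hp
    have h0 : ∑ x, p x = 0 := key p 0 (by simp) fun w => congrFun hp w
    have hLp : L.mulVec p = 0 := by
      ext w
      have := congrFun hp w
      simpa [f, h0] using this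
    rw [hL, lapMatrix_mulVec_eq_zero_iff_forall_reachable] at hLp
    ext w
    have h3 : ∑ x, p x = ∑ _x : V, p w :=
      Finset.sum_congr rfl fun x _ => hLp x w (hG.preconnected x w)
    rw [h0] at h3
    simpa [hcard] using h3.symm
  obtain ⟨p, hp⟩ := (LinearMap.injective_iff_surjective.mp hf) (Pi.single u 1 - Pi.single v 1)
  have h0 : ∑ x, p x = 0 := key p (Pi.single u 1 - Pi.single v 1) (by simp) fun w => congrFun hp w
  refine ⟨p, ?_⟩
  ext w
  have := congrFun hp w
  simpa [f, h0] using this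

open Classical in
/-- The resistance distance between `u` and `v`: the potential difference between them when a unit
current flows from `u` to `v` and each edge is a unit resistor. (It is set to `0` when no such
current exists, which never happens in a connected graph.) -/
noncomputable def resistanceDist (u v : V) : ℝ :=
  if h : ∃ p : V → ℝ, G.IsUnitCurrentPotential u v p then h.choose u - h.choose v else 0

/-- The resistance distance can be read off any potential of a unit current. -/
theorem IsUnitCurrentPotential.resistanceDist_eq {G : SimpleGraph V} [DecidableRel G.Adj] {u v : V}
    {p : V → ℝ} (hp : G.IsUnitCurrentPotential u v p) : G.resistanceDist u v = p u - p v := by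
  have h : ∃ p : V → ℝ, G.IsUnitCurrentPotential u v p := ⟨p, hp⟩
  rw [resistanceDist, dif_pos h]
  exact h.choose_spec.sub_eq hp

/-- The multiplicative degree-Kirchhoff index: the sum of `dᵤ dᵥ rᵤᵥ` over the unordered pairs of
distinct vertices (`offDiag` lists each of them twice). -/
noncomputable def multDegreeKirchhoffIndex : ℝ :=
  (∑ e ∈ (Finset.univ : Finset V).offDiag,
    (G.degree e.1 : ℝ) * (G.degree e.2 : ℝ) * G.resistanceDist e.1 e.2) / 2

/-- The Gutman index: the sum of `dᵤ dᵥ dist(u, v)` over the unordered pairs of distinct vertices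
(`offDiag` lists each of them twice). -/
noncomputable def gutmanIndex : ℝ :=
  (∑ e ∈ (Finset.univ : Finset V).offDiag,
    (G.degree e.1 : ℝ) * (G.degree e.2 : ℝ) * (G.dist e.1 e.2 : ℝ)) / 2

end ElectricalNetwork

end SimpleGraph

/-- The linear crossed octagonal graph `O_n`. The vertices are arranged in two rows of `3 n + 1`
columns, `(i, r)` being the vertex of row `r` in column `i`, with columns numbered from `0`. In the
linear chain of `n` octagons, the octagon number `s < n` has the columns `3 s, …, 3 s + 3`: its
edges join consecutive vertices of the same row, and the two vertices of each of its first and last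
columns. Each octagon gets in addition three pairs of crossed edges, which join vertices of
different rows in consecutive columns. Hence two vertices in consecutive columns are always
adjacent, and the two vertices of column `i` are adjacent exactly when `3 ∣ i`. -/
def linearCrossedOctagonal (n : ℕ) : SimpleGraph (Fin (3 * n + 1) × Fin 2) where
  Adj x y := x.1.val + 1 = y.1.val ∨ y.1.val + 1 = x.1.val ∨
    (x.1 = y.1 ∧ x.2 ≠ y.2 ∧ 3 ∣ x.1.val)
  symm := ⟨by
    rintro x y (h | h | ⟨h, h', h''⟩)
    · exact Or.inr (Or.inl h)
    · exact Or.inl h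
    · exact Or.inr (Or.inr ⟨h.symm, h'.symm, h ▸ h''⟩)⟩
  loopless := ⟨by
    rintro x (h | h | ⟨-, h, -⟩)
    · omega
    · omega
    · exact h rfl⟩

instance (n : ℕ) : DecidableRel (linearCrossedOctagonal n).Adj := fun x y =>
  inferInstanceAs (Decidable (x.1.val + 1 = y.1.val ∨ y.1.val + 1 = x.1.val ∨
    (x.1 = y.1 ∧ x.2 ≠ y.2 ∧ 3 ∣ x.1.val)))

/-! Consecutive columns are joined by all four possible edges. A potential that is constant on
columns therefore sees a path whose links are four parallel unit resistors, of resistance 1/4 each.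
A potential opposite on the two vertices of one column and zero elsewhere is an eigenvector of the
Laplacian, since its effect on the neighbouring columns cancels. Superposing the two kinds gives an
explicit Green function, hence the resistance between columns `i` and `j`: `|i - j| / 4` plus a
bounded term (`resistanceDist_eq`). The graph distance is `|i - j|` up to at most 2. So `4 r - d` is
bounded; with bounded degrees and O(n²) pairs, `4 Kf* - Gut` is O(n²), while `Gut` is at least `n ^
3`. The ratio thus differs from 1/4 by O(1/n). -/

namespace SimpleGraph

/-- The Laplacian at a vertex is the sum of the potential drops along the incident edges. -/
theorem lapMatrix_mulVec_eq_sum_ite {V : Type*} [Fintype V] [DecidableEq V] (G : SimpleGraph V)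
    [DecidableRel G.Adj] (p : V → ℝ) (w : V) :
    (G.lapMatrix ℝ).mulVec p w = ∑ x, if G.Adj w x then p w - p x else 0 := by
  rw [lapMatrix_mulVec_apply, ← Finset.sum_filter, Finset.sum_sub_distrib, Finset.sum_const,
    nsmul_eq_mul, ← neighborFinset_eq_filter, card_neighborFinset_eq_degree]

end SimpleGraph

/-! ### Sums over neighbours and degrees -/

theorem sum_fin_ite_succ_eq (N k : ℕ) (h : ℕ → ℝ) :
    ∑ m : Fin N, (if k + 1 = m.val then h m.val else 0) = if k + 1 < N then h (k + 1) else 0 := by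
  rw [Fin.sum_univ_eq_sum_range (fun m => if k + 1 = m then h m else 0) N,
    Finset.sum_ite_eq]
  simp

theorem sum_fin_ite_eq_succ (N k : ℕ) (hk : k < N) (h : ℕ → ℝ) :
    ∑ m : Fin N, (if m.val + 1 = k then h m.val else 0) = if 0 < k then h (k - 1) else 0 := by
  rw [Fin.sum_univ_eq_sum_range (fun m => if m + 1 = k then h m else 0) N]
  rcases k with _ | k
  · simp
  · simp only [Nat.add_right_cancel_iff, Finset.sum_ite_eq', Finset.mem_range]
    simp [show k < N by omega]

namespace linearCrossedOctagonal

/-- A sum over the neighbours of a vertex, split into the next column, the previous column and the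
other vertex of the same column. -/
theorem sum_ite_adj (n : ℕ) (F : ℕ → Fin 2 → ℝ) (w : Fin (3 * n + 1) × Fin 2) :
    (∑ x, if (linearCrossedOctagonal n).Adj w x then F x.1.val x.2 else 0) =
      (if w.1.val + 1 < 3 * n + 1 then F (w.1.val + 1) 0 + F (w.1.val + 1) 1 else 0) +
      (if 0 < w.1.val then F (w.1.val - 1) 0 + F (w.1.val - 1) 1 else 0) +
      (if 3 ∣ w.1.val then F w.1.val (1 - w.2) else 0) := by
  obtain ⟨k, c⟩ := w
  have split : ∀ m : Fin (3 * n + 1), ∀ c' : Fin 2,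
      (if (linearCrossedOctagonal n).Adj (k, c) (m, c') then F m.val c' else 0) =
        (if k.val + 1 = m.val then F m.val c' else 0) +
        (if m.val + 1 = k.val then F m.val c' else 0) +
        (if k = m then (if c ≠ c' ∧ 3 ∣ k.val then F k.val c' else 0) else 0) := by
    intro m c'
    simp only [linearCrossedOctagonal]
    by_cases h1 : k.val + 1 = m.val
    · have h2 : ¬ m.val + 1 = k.val := by omega
      have h3 : ¬ k = m := by rintro rfl; omega
      simp [h1, h2, h3]
    · by_cases h2 : m.val + 1 = k.val
      · have h3 : ¬ k = m := by rintro rfl; omega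
        simp [h1, h2, h3]
      · by_cases h3 : k = m
        · subst h3; simp
        · simp [h1, h2, h3]
  rw [Fintype.sum_prod_type]
  simp only [split, Fin.sum_univ_two, Finset.sum_add_distrib,
    sum_fin_ite_succ_eq _ _ fun m => F m 0, sum_fin_ite_succ_eq _ _ fun m => F m 1,
    sum_fin_ite_eq_succ _ _ k.isLt fun m => F m 0, sum_fin_ite_eq_succ _ _ k.isLt fun m => F m 1,
    Finset.sum_ite_eq, Finset.mem_univ, if_true]
  have : (if c ≠ 0 ∧ 3 ∣ k.val then F k.val 0 else 0) + (if c ≠ 1 ∧ 3 ∣ k.val then F k.val 1 else 0)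
      = if 3 ∣ k.val then F k.val (1 - c) else 0 := by
    fin_cases c <;> simp
  rw [← this]
  split_ifs <;> ring

theorem degree_eq (n : ℕ) (w : Fin (3 * n + 1) × Fin 2) :
    ((linearCrossedOctagonal n).degree w : ℝ) =
      (if w.1.val + 1 < 3 * n + 1 then 2 else 0) + (if 0 < w.1.val then 2 else 0) +
      (if 3 ∣ w.1.val then 1 else 0) := by
  have := sum_ite_adj n (fun _ _ => 1) w
  rw [Finset.sum_boole, ← SimpleGraph.neighborFinset_eq_filter,
    SimpleGraph.card_neighborFinset_eq_degree] at this
  rw [this]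
  norm_num

theorem degree_le (n : ℕ) (w : Fin (3 * n + 1) × Fin 2) :
    ((linearCrossedOctagonal n).degree w : ℝ) ≤ 5 := by
  rw [degree_eq]
  split_ifs <;> norm_num

theorem one_le_degree {n : ℕ} (hn : 1 ≤ n) (w : Fin (3 * n + 1) × Fin 2) :
    (1 : ℝ) ≤ (linearCrossedOctagonal n).degree w := by
  rw [degree_eq]
  split_ifs <;> first | (exfalso; omega) | norm_num

/-! ### The Green function and resistance distances -/

/-- The eigenvalue of the Laplacian at the difference of the two vertices of column `k`. -/
noncomputable def columnEigenvalue (n k : ℕ) : ℝ :=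
  (if k + 1 < 3 * n + 1 then 2 else 0) + (if 0 < k then 2 else 0) + (if 3 ∣ k then 2 else 0)

theorem two_le_columnEigenvalue (n k : ℕ) : 2 ≤ columnEigenvalue n k := by
  unfold columnEigenvalue
  -- Column 0 has no predecessor, but 3 divides 0, so its own vertical edge contributes 2.
  rcases Nat.eq_zero_or_pos k with rfl | h
  · split_ifs <;> norm_num at *
  · split_ifs <;> norm_num

/-- The potential of a unit current entering at row `a` of column `i` and leaving, in equal parts,
at the vertices of the first and the last column. -/
noncomputable def greenFunction (n i : ℕ) (a : Fin 2) (k : ℕ) (c : Fin 2) : ℝ :=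
  -|(k : ℝ) - i| / 8 +
    if k = i then (if c = a then 1 else -1) / (2 * columnEigenvalue n i) else 0

theorem greenFunction_add (n i : ℕ) (a : Fin 2) (k : ℕ) :
    greenFunction n i a k 0 + greenFunction n i a k 1 = -|(k : ℝ) - i| / 4 := by
  unfold greenFunction
  fin_cases a <;> simp <;> split_ifs <;> ring

theorem greenFunction_sub (n i : ℕ) (a : Fin 2) (k : ℕ) (c : Fin 2) :
    greenFunction n i a k c + |(k : ℝ) - i| / 8 =
      if k = i then (if c = a then 1 else -1) / (2 * columnEigenvalue n i) else 0 := by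
  unfold greenFunction
  ring

theorem greenFunction_other_row (n i : ℕ) (a : Fin 2) (k : ℕ) (c : Fin 2) :
    greenFunction n i a k (1 - c) = -|(k : ℝ) - i| / 4 - greenFunction n i a k c := by
  rw [← greenFunction_add n i a k]
  fin_cases c <;> simp

/-- The slope of `|· - i|` jumps by 2 at `i`; each end of the path lacks one neighbour, which costs
1 there. -/
theorem abs_sub_second_difference {n i k : ℕ} (hi : i ≤ 3 * n) (hk : k ≤ 3 * n) :
    (if k + 1 < 3 * n + 1 then |((k + 1 : ℕ) : ℝ) - i| - |(k : ℝ) - i| else 0) +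
      (if 0 < k then |((k - 1 : ℕ) : ℝ) - i| - |(k : ℝ) - i| else 0) =
      (if k = i then 2 else 0) - (if k = 0 then 1 else 0) - (if k = 3 * n then 1 else 0) := by
  have hcast : 0 < k → ((k - 1 : ℕ) : ℝ) = k - 1 := fun h => by rw [Nat.cast_sub h]; simp
  rcases lt_trichotomy k i with h | rfl | h
  · have h' : (k : ℝ) + 1 ≤ i := by exact_mod_cast h
    rw [if_pos (by omega), if_neg (show ¬ k = i by omega), if_neg (show ¬ k = 3 * n by omega),
      Nat.cast_succ, abs_of_nonpos (by linarith), abs_of_nonpos (by linarith : (k : ℝ) - i ≤ 0)]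
    rcases Nat.eq_zero_or_pos k with h0 | h0
    · simp [h0]
    · rw [if_pos h0, hcast h0, abs_of_nonpos (by linarith), if_neg (by omega)]; ring
  · have e1 : (if k + 1 < 3 * n + 1 then |((k + 1 : ℕ) : ℝ) - k| - |(k : ℝ) - k| else 0) =
        1 - if k = 3 * n then (1 : ℝ) else 0 := by
      split_ifs <;> first | omega | simp
    have e2 : (if 0 < k then |((k - 1 : ℕ) : ℝ) - k| - |(k : ℝ) - k| else 0) =
        1 - if k = 0 then (1 : ℝ) else 0 := by
      split_ifs with h0 h1 <;> first | omega | simp [*]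
    rw [e1, e2, if_pos rfl]; ring
  · have h' : (i : ℝ) + 1 ≤ k := by exact_mod_cast h
    have h0 : 0 < k := by omega
    rw [if_pos h0, hcast h0, if_neg (show ¬ k = i by omega), if_neg (show ¬ k = 0 by omega),
      Nat.cast_succ, abs_of_nonneg (by linarith : (0 : ℝ) ≤ k + 1 - i),
      abs_of_nonneg (by linarith : (0 : ℝ) ≤ k - i),
      abs_of_nonneg (by linarith : (0 : ℝ) ≤ (k : ℝ) - 1 - i)]
    split_ifs <;> first | omega | ring

/-- The correction at the end columns does not depend on `u`, so the difference of two Green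
functions is a unit current potential. -/
theorem lapMatrix_mulVec_greenFunction (n : ℕ) (u w : Fin (3 * n + 1) × Fin 2) :
    ((linearCrossedOctagonal n).lapMatrix ℝ).mulVec
        (fun x => greenFunction n u.1.val u.2 x.1.val x.2) w =
      Pi.single (M := fun _ => ℝ) u 1 w -
        ((if w.1.val = 0 then 1 else 0) + if w.1.val = 3 * n then 1 else 0) / 4 := by
  obtain ⟨i, a⟩ := u
  obtain ⟨k, c⟩ := w
  rw [SimpleGraph.lapMatrix_mulVec_eq_sum_ite,
    sum_ite_adj n (fun m c' => greenFunction n i a k c - greenFunction n i a m c')]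
  have hD := two_le_columnEigenvalue n i
  -- Another column acts only through its row sum, in which the antisymmetric term cancels.
  have hsum (m : ℕ) : (greenFunction n i a k c - greenFunction n i a m 0) +
      (greenFunction n i a k c - greenFunction n i a m 1) =
      (|(m : ℝ) - i| - |(k.val : ℝ) - i|) / 4 +
        2 * (greenFunction n i a k c + |(k.val : ℝ) - i| / 8) := by
    linear_combination -(greenFunction_add n i a m)
  have hself : greenFunction n i a k c - greenFunction n i a k (1 - c) =
      2 * (greenFunction n i a k c + |(k.val : ℝ) - i| / 8) := by
    rw [greenFunction_other_row]; ring
  -- The unit source splits into 1/2 on both vertices of its column and ±1/2 antisymmetrically.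
  have hpi : Pi.single (M := fun _ => ℝ) (i, a) 1 (k, c) = (if k.val = i.val then 2 else 0) / 4 +
      columnEigenvalue n k * (greenFunction n i a k c + |(k.val : ℝ) - i| / 8) := by
    rw [greenFunction_sub, Pi.single_apply]
    by_cases h : k = i
    · subst h
      by_cases h' : c = a
      · subst h'
        simp only [if_true]
        field_simp
        norm_num
      · simp only [h', if_true, if_false, Prod.mk.injEq, and_false]
        field_simp
        norm_num
    · simp [h, Fin.val_inj]
  have hsd := abs_sub_second_difference (n := n) (i := i) (k := k) (by omega) (by omega)
  simp only [hsum, hself]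
  rw [hpi]
  unfold columnEigenvalue
  generalize greenFunction n i a k c + |(k.val : ℝ) - i| / 8 = g at *
  have e : ∀ (P : Prop) [Decidable P] (x y : ℝ),
      (if P then x / 4 + 2 * y else 0) = (if P then x else 0) / 4 + (if P then 2 else 0) * y := by
    intro P _ x y; split_ifs <;> ring
  have e' : (if 3 ∣ k.val then 2 * g else 0) = (if 3 ∣ k.val then 2 else 0) * g := by
    split_ifs <;> ring
  simp only [e, e']
  linear_combination hsd / 4

theorem resistanceDist_eq {n : ℕ} {u v : Fin (3 * n + 1) × Fin 2} (h : u ≠ v) :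
    (linearCrossedOctagonal n).resistanceDist u v = |(u.1.val : ℝ) - v.1.val| / 4 +
      if u.1 = v.1 then 2 / columnEigenvalue n u.1.val else
        1 / (2 * columnEigenvalue n u.1.val) + 1 / (2 * columnEigenvalue n v.1.val) := by
  have hp : (linearCrossedOctagonal n).IsUnitCurrentPotential u v
      ((fun x => greenFunction n u.1.val u.2 x.1.val x.2) -
        fun x => greenFunction n v.1.val v.2 x.1.val x.2) := by
    unfold SimpleGraph.IsUnitCurrentPotential
    rw [Matrix.mulVec_sub]
    ext w
    rw [Pi.sub_apply, Pi.sub_apply, lapMatrix_mulVec_greenFunction, lapMatrix_mulVec_greenFunction]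
    ring
  rw [hp.resistanceDist_eq]
  obtain ⟨i, a⟩ := u
  obtain ⟨j, b⟩ := v
  simp only [Pi.sub_apply, greenFunction, abs_sub_comm (j.val : ℝ) i.val]
  by_cases hij : i = j
  · subst hij
    have hab : a ≠ b := fun hab => h (by rw [hab])
    simp [hab, hab.symm]
    ring
  · have h1 : ¬ i.val = j.val := fun h => hij (Fin.ext h)
    have h2 : ¬ j.val = i.val := fun h => h1 h.symm
    simp [h1, h2, hij]
    ring

theorem abs_sub_div_four_le_resistanceDist {n : ℕ} {u v : Fin (3 * n + 1) × Fin 2} (h : u ≠ v) :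
    |(u.1.val : ℝ) - v.1.val| / 4 ≤ (linearCrossedOctagonal n).resistanceDist u v := by
  have hu := two_le_columnEigenvalue n u.1.val
  have hv := two_le_columnEigenvalue n v.1.val
  rw [resistanceDist_eq h]
  refine le_add_of_nonneg_right ?_
  split_ifs <;> positivity

theorem resistanceDist_le_abs_sub_div_four_add_one {n : ℕ} {u v : Fin (3 * n + 1) × Fin 2}
    (h : u ≠ v) :
    (linearCrossedOctagonal n).resistanceDist u v ≤ |(u.1.val : ℝ) - v.1.val| / 4 + 1 := by
  have key (k : ℕ) : 1 / (2 * columnEigenvalue n k) ≤ 1 / 4 :=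
    one_div_le_one_div_of_le (by norm_num) (by linarith [two_le_columnEigenvalue n k])
  have hu := two_le_columnEigenvalue n u.1.val
  rw [resistanceDist_eq h]
  gcongr
  split_ifs
  · exact (div_le_one (by linarith)).mpr hu
  · linarith [key u.1.val, key v.1.val]

/-! ### Shortest-path distances -/

theorem abs_sub_le_length {n : ℕ} {u v : Fin (3 * n + 1) × Fin 2}
    (p : (linearCrossedOctagonal n).Walk u v) : |(u.1.val : ℝ) - v.1.val| ≤ p.length := by
  induction p with
  | nil => simp
  | @cons x y z hxy p ih =>
    have hstep : |(x.1.val : ℝ) - y.1.val| ≤ 1 := by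
      rcases hxy with h | h | ⟨h, -⟩
      · rw [← h]; simp
      · rw [← h]; simp
      · rw [h]; simp
    have := abs_sub_le (x.1.val : ℝ) y.1.val z.1.val
    rw [SimpleGraph.Walk.length_cons]
    push_cast
    linarith

theorem exists_walk_of_lt {n d : ℕ} {u v : Fin (3 * n + 1) × Fin 2}
    (h : u.1.val + (d + 1) = v.1.val) :
    ∃ p : (linearCrossedOctagonal n).Walk u v, p.length = d + 1 := by
  induction d generalizing u with
  | zero => exact ⟨SimpleGraph.Walk.cons (Or.inl h) .nil, rfl⟩
  | succ d ih =>
    -- Row 0 is an arbitrary choice: the last step can reach either row.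
    obtain ⟨p, hp⟩ := ih (u := (⟨u.1.val + 1, by omega⟩, 0)) (by simp only; omega)
    have hadj : (linearCrossedOctagonal n).Adj u (⟨u.1.val + 1, by omega⟩, 0) := Or.inl rfl
    exact ⟨.cons hadj p, by rw [SimpleGraph.Walk.length_cons, hp]⟩

theorem exists_walk_length_le {n : ℕ} (hn : 1 ≤ n) (u v : Fin (3 * n + 1) × Fin 2) :
    ∃ p : (linearCrossedOctagonal n).Walk u v, (p.length : ℝ) ≤ |(u.1.val : ℝ) - v.1.val| + 2 := by
  rcases lt_trichotomy u.1.val v.1.val with h | h | h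
  · obtain ⟨d, hd⟩ := Nat.exists_eq_add_of_lt h
    obtain ⟨p, hp⟩ := exists_walk_of_lt (u := u) (v := v) (d := d) (by omega)
    refine ⟨p, ?_⟩
    rw [hp, hd, abs_sub_comm]
    push_cast
    linarith [le_abs_self ((u.1.val : ℝ) + d + 1 - u.1.val)]
  -- Within a column, a detour through an adjacent column has length 2.
  · have hadj : ∃ w, (linearCrossedOctagonal n).Adj u w ∧ (linearCrossedOctagonal n).Adj w v := by
      by_cases h0 : u.1.val = 0
      · exact ⟨(⟨1, by omega⟩, 0), Or.inl (by simp [h0]), Or.inr (Or.inl (by simp [← h, h0]))⟩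
      · exact ⟨(⟨u.1.val - 1, by omega⟩, 0), Or.inr (Or.inl (by simp only; omega)),
          Or.inl (by simp only; omega)⟩
    obtain ⟨w, h1, h2⟩ := hadj
    exact ⟨.cons h1 (.cons h2 .nil), by simp⟩
  · obtain ⟨d, hd⟩ := Nat.exists_eq_add_of_lt h
    obtain ⟨p, hp⟩ := exists_walk_of_lt (u := v) (v := u) (d := d) (by omega)
    refine ⟨p.reverse, ?_⟩
    rw [SimpleGraph.Walk.length_reverse, hp, hd]
    push_cast
    linarith [le_abs_self ((v.1.val : ℝ) + d + 1 - v.1.val)]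

theorem abs_sub_le_dist {n : ℕ} (hn : 1 ≤ n) (u v : Fin (3 * n + 1) × Fin 2) :
    |(u.1.val : ℝ) - v.1.val| ≤ (linearCrossedOctagonal n).dist u v := by
  obtain ⟨q, -⟩ := exists_walk_length_le hn u v
  obtain ⟨p, hp⟩ := q.reachable.exists_walk_length_eq_dist
  exact hp ▸ abs_sub_le_length p

theorem dist_le_abs_sub_add_two {n : ℕ} (hn : 1 ≤ n) (u v : Fin (3 * n + 1) × Fin 2) :
    ((linearCrossedOctagonal n).dist u v : ℝ) ≤ |(u.1.val : ℝ) - v.1.val| + 2 := by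
  obtain ⟨p, hp⟩ := exists_walk_length_le hn u v
  exact le_trans (by exact_mod_cast SimpleGraph.dist_le p) hp

/-! ### Sums of column distances -/

theorem sum_range_abs_sub (m : ℕ) :
    ∑ j ∈ Finset.range m, |(m : ℝ) - j| = m * (m + 1) / 2 := by
  have h : ∑ j ∈ Finset.range m, |(m : ℝ) - j| = ∑ j ∈ Finset.range m, ((m : ℝ) - j) :=
    Finset.sum_congr rfl fun j hj => abs_of_nonneg <| by
      have : (j : ℝ) ≤ m := by exact_mod_cast (Finset.mem_range.mp hj).le
      linarith
  have hid : ∀ k : ℕ, ∑ j ∈ Finset.range k, (j : ℝ) = k * (k - 1) / 2 := by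
    intro k
    induction k with
    | zero => simp
    | succ k ih => rw [Finset.sum_range_succ, ih]; push_cast; ring
  rw [h, Finset.sum_sub_distrib, hid]
  simp
  ring

theorem sum_range_sum_range_abs_sub (m : ℕ) :
    ∑ i ∈ Finset.range m, ∑ j ∈ Finset.range m, |(i : ℝ) - j| = ((m : ℝ) ^ 3 - m) / 3 := by
  induction m with
  | zero => simp
  | succ m ih =>
    simp only [Finset.sum_range_succ, Finset.sum_add_distrib, ih, sub_self, abs_zero]
    simp only [fun i : ℕ => abs_sub_comm (i : ℝ) (m : ℝ), sum_range_abs_sub]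
    push_cast
    ring

theorem sum_offDiag_abs_sub (n : ℕ) :
    ∑ e ∈ (Finset.univ : Finset (Fin (3 * n + 1) × Fin 2)).offDiag,
      |(e.1.1.val : ℝ) - e.2.1.val| = 4 * (((3 * n + 1 : ℝ)) ^ 3 - (3 * n + 1)) / 3 := by
  have h : ∑ e ∈ (Finset.univ : Finset (Fin (3 * n + 1) × Fin 2)).offDiag,
      |(e.1.1.val : ℝ) - e.2.1.val| =
      ∑ e : (Fin (3 * n + 1) × Fin 2) × (Fin (3 * n + 1) × Fin 2),
        |(e.1.1.val : ℝ) - e.2.1.val| := by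
    refine Finset.sum_subset (Finset.subset_univ _) fun e _ he => ?_
    have : e.1 = e.2 := by simpa using he
    simp [this]
  have hr := sum_range_sum_range_abs_sub (3 * n + 1)
  simp only [← Fin.sum_univ_eq_sum_range (fun j => |(_ : ℝ) - (j : ℝ)|),
    ← Fin.sum_univ_eq_sum_range (fun i => ∑ j : Fin (3 * n + 1), |(i : ℝ) - (j.val : ℝ)|)] at hr
  rw [h]
  simp only [Fintype.sum_prod_type, Fin.sum_univ_two, Finset.sum_add_distrib, hr]
  push_cast
  ring

/-! ### Comparison of the two indices -/

theorem cube_le_gutmanIndex {n : ℕ} (hn : 1 ≤ n) :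
    (n : ℝ) ^ 3 ≤ (linearCrossedOctagonal n).gutmanIndex := by
  have h : ∑ e ∈ (Finset.univ : Finset (Fin (3 * n + 1) × Fin 2)).offDiag,
      |(e.1.1.val : ℝ) - e.2.1.val| ≤ 2 * (linearCrossedOctagonal n).gutmanIndex := by
    rw [SimpleGraph.gutmanIndex, mul_div_cancel₀ _ two_ne_zero]
    refine Finset.sum_le_sum fun e _ => (abs_sub_le_dist hn e.1 e.2).trans ?_
    exact le_mul_of_one_le_left (Nat.cast_nonneg _)
      (one_le_mul_of_one_le_of_one_le (one_le_degree hn _) (one_le_degree hn _))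
  rw [sum_offDiag_abs_sub] at h
  have : (0 : ℝ) ≤ n := Nat.cast_nonneg n
  nlinarith [pow_nonneg this 2, pow_nonneg this 3]

theorem abs_four_mul_multDegreeKirchhoffIndex_sub_gutmanIndex_le {n : ℕ} (hn : 1 ≤ n) :
    |4 * (linearCrossedOctagonal n).multDegreeKirchhoffIndex -
      (linearCrossedOctagonal n).gutmanIndex| ≤ 3200 * (n : ℝ) ^ 2 := by
  set G := linearCrossedOctagonal n
  set s := (Finset.univ : Finset (Fin (3 * n + 1) × Fin 2)).offDiag with hs
  have h1 : 4 * G.multDegreeKirchhoffIndex - G.gutmanIndex =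
      (∑ e ∈ s, (G.degree e.1 : ℝ) * (G.degree e.2 : ℝ) *
        (4 * G.resistanceDist e.1 e.2 - G.dist e.1 e.2)) / 2 := by
    simp only [SimpleGraph.multDegreeKirchhoffIndex, SimpleGraph.gutmanIndex, mul_sub,
      Finset.sum_sub_distrib, mul_left_comm _ (4 : ℝ), ← Finset.mul_sum, ← hs]
    ring
  have h2 : ∀ e ∈ s, |(G.degree e.1 : ℝ) * (G.degree e.2 : ℝ) *
      (4 * G.resistanceDist e.1 e.2 - G.dist e.1 e.2)| ≤ 100 := by
    intro e he
    have hne : e.1 ≠ e.2 := by simpa [hs] using he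
    have hr := abs_sub_div_four_le_resistanceDist hne
    have hr' := resistanceDist_le_abs_sub_div_four_add_one hne
    have hd := abs_sub_le_dist hn e.1 e.2
    have hd' := dist_le_abs_sub_add_two hn e.1 e.2
    have hdiff : |4 * G.resistanceDist e.1 e.2 - G.dist e.1 e.2| ≤ 4 :=
      abs_le.mpr ⟨by linarith, by linarith⟩
    rw [abs_mul, abs_of_nonneg (by positivity : (0 : ℝ) ≤ G.degree e.1 * G.degree e.2)]
    calc (G.degree e.1 : ℝ) * G.degree e.2 * |4 * G.resistanceDist e.1 e.2 - G.dist e.1 e.2|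
        ≤ 5 * 5 * 4 := by
          gcongr
          · exact degree_le n e.1
          · exact degree_le n e.2
      _ = 100 := by norm_num
  have hcard : (s.card : ℝ) ≤ (2 * (3 * n + 1)) ^ 2 := by
    have : s.card ≤ (2 * (3 * n + 1)) ^ 2 := by
      rw [hs, Finset.offDiag_card]
      simp only [Finset.card_univ, Fintype.card_prod, Fintype.card_fin]
      exact (Nat.sub_le _ _).trans (by rw [mul_comm 2, sq])
    exact_mod_cast this
  -- As `3 n + 1 ≤ 4 n`, the bound is `100 * (8 n) ^ 2 / 2 = 3200 n ^ 2`.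
  have hn' : (1 : ℝ) ≤ n := by exact_mod_cast hn
  have h3 := (Finset.abs_sum_le_sum_abs _ s).trans (Finset.sum_le_card_nsmul s _ 100 h2)
  rw [nsmul_eq_mul] at h3
  rw [h1, abs_div, abs_two]
  nlinarith

end linearCrossedOctagonal

open linearCrossedOctagonal in
theorem theorem1p5 :
    Tendsto
      (fun n : ℕ => (linearCrossedOctagonal n).multDegreeKirchhoffIndex /
        (linearCrossedOctagonal n).gutmanIndex)
      atTop (𝓝 (1 / 4 : ℝ)) := by
  rw [tendsto_iff_norm_sub_tendsto_zero]
  refine squeeze_zero' (Eventually.of_forall fun _ => norm_nonneg _) ?_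
    (tendsto_const_div_atTop_nhds_zero_nat 800)
  filter_upwards [eventually_ge_atTop 1] with n hn
  have hn' : (1 : ℝ) ≤ n := by exact_mod_cast hn
  have hG := cube_le_gutmanIndex hn
  have hK := abs_four_mul_multDegreeKirchhoffIndex_sub_gutmanIndex_le hn
  have hpos : 0 < (linearCrossedOctagonal n).gutmanIndex := lt_of_lt_of_le (by positivity) hG
  have e : (linearCrossedOctagonal n).multDegreeKirchhoffIndex /
      (linearCrossedOctagonal n).gutmanIndex - 1 / 4 =
      (4 * (linearCrossedOctagonal n).multDegreeKirchhoffIndex -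
        (linearCrossedOctagonal n).gutmanIndex) / (4 * (linearCrossedOctagonal n).gutmanIndex) := by
    field_simp
  rw [e, Real.norm_eq_abs, abs_div, abs_of_pos (by positivity : 0 < 4 *
    (linearCrossedOctagonal n).gutmanIndex), div_le_div_iff₀ (by positivity) (by positivity)]
  calc _ ≤ 3200 * (n : ℝ) ^ 2 * n := by gcongr
    _ = 800 * (4 * (n : ℝ) ^ 3) := by ring
    _ ≤ _ := by gcongr
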